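/- For integers $r,s$ put $f_{r,s}(X)=(X^2-r)^2-X-s$. Suppose that $f_{r,s}$ is irreducible over $\mathbb{Q}$ and that its splitting field has Galois group $S_4$, and let $K=K_{r,s}$ be the field generated over $\mathbb{Q}$ by a zero of $f_{r,s}$. Consider sequences of pairs $(\alpha_m,\beta_m)$ $(m=1,2,\dots)$ of algebraic integers in $K$ such that (i) for every $m$ we have $\mathbb{Q}(\alpha_m)=\mathbb{Q}(\beta_m)=K$, $\beta_m=\alpha_m^2+r_m$ and $\alpha_m=\beta_m^2+s_m$ for certain $r_m,s_m\in\mathbb{Z}$; (ii) there are infinitely many distinct orders among the $\mathbb{Z}[\alpha_m]$. For polynomials $f,g\in\mathbb{Z}[X]$ of degree $n$, with $f=f_0\prod_{i=1}^n(X-\gamma_i)$ over $\mathbb{C}$, put $$[f](X_1,\dots,X_n)=f_0^{\,n-1}\prod_{i=1}^n\left(\gamma_i^{n-1}X_1+\gamma_i^{n-2}X_2+\cdots+X_n\right).$$ Call $f$ and $g$ Hermite equivalent if $[g](U\underline{X})=\pm[f](\underline{X})$ for some $U\in\mathrm{GL}_n(\mathbb{Z})$, where $\underline{X}=(X_1,\dots,X_n)^T$.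 Call them $\mathrm{GL}_2(\mathbb{Z})$-equivalent if $G(X,Y)=\pm F(aX+bY,cX+dY)$ for some $\left(\begin{smallmatrix}a&b\\c&d\end{smallmatrix}\right)\in\mathrm{GL}_2(\mathbb{Z})$, where $F(X,Y)=Y^nf(X/Y)$ and $G(X,Y)=Y^ng(X/Y)$. Theorem. There is a sequence of pairwise distinct pairs $(\alpha_m,\beta_m)$ in $K$ satisfying (i) and (ii). For every sequence satisfying (i) and (ii), let $f_m,g_m\in\mathbb{Z}[X]$ be the monic minimal polynomials of $\alpha_m$ and $\beta_m$. Then the polynomials $f_m$ lie in infinitely many distinct Hermite equivalence classes. Moreover, for each $m$, the polynomials $f_m$ and $g_m$ are Hermite equivalent but not $\mathrm{GL}_2(\mathbb{Z})$-equivalent. -/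

import Mathlib

open Polynomial

/-- The linear substitution `P(X) ↦ P(A X)`, where `X` is the column vector of the variables and
`A` is an integral `n × n` matrix. -/
noncomputable def linSubst {R : Type*} [CommRing R] {n : ℕ} (A : Matrix (Fin n) (Fin n) ℤ) :
    MvPolynomial (Fin n) R →ₐ[R] MvPolynomial (Fin n) R :=
  MvPolynomial.aeval fun i => ∑ j, MvPolynomial.C (A i j : R) * MvPolynomial.X j

theorem linSubst_linSubst {R : Type*} [CommRing R] {n : ℕ} (A B : Matrix (Fin n) (Fin n) ℤ)
    (P : MvPolynomial (Fin n) R) :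
    linSubst B (linSubst A P) = linSubst (A * B) P := by
  have h : (linSubst B).comp (linSubst A) = linSubst (R := R) (A * B) := by
    apply MvPolynomial.algHom_ext
    intro i
    simp only [linSubst, AlgHom.comp_apply, MvPolynomial.aeval_X, map_sum, map_mul,
      MvPolynomial.algHom_C, MvPolynomial.algebraMap_eq, Matrix.mul_apply, Int.cast_sum,
      Int.cast_mul, Finset.mul_sum, Finset.sum_mul]
    rw [Finset.sum_comm]
    simp only [mul_assoc]
  exact DFunLike.congr_fun h P

theorem linSubst_one {R : Type*} [CommRing R] {n : ℕ} (P : MvPolynomial (Fin n) R) :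
    linSubst (1 : Matrix (Fin n) (Fin n) ℤ) P = P := by
  have h : linSubst (1 : Matrix (Fin n) (Fin n) ℤ) = AlgHom.id R (MvPolynomial (Fin n) R) := by
    apply MvPolynomial.algHom_ext
    intro i
    simp [linSubst, Matrix.one_apply, apply_ite, ite_mul]
  exact DFunLike.congr_fun h P

/-- For `f = f₀ (X - α₁) ⋯ (X - αₙ)` of degree `n ≥ 1`, the decomposable form
`[f] = f₀ ^ (n - 1) ∏ᵢ (αᵢ ^ (n - 1) X₁ + αᵢ ^ (n - 2) X₂ + ⋯ + Xₙ)` in `n` variables,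
the product being over the complex zeros of `f` counted with multiplicity. -/
noncomputable def hermiteForm (n : ℕ) (f : ℤ[X]) : MvPolynomial (Fin n) ℂ :=
  MvPolynomial.C ((f.leadingCoeff : ℂ) ^ (n - 1)) *
    ((f.map (Int.castRingHom ℂ)).roots.map fun a =>
      ∑ i : Fin n, MvPolynomial.C (a ^ (n - 1 - (i : ℕ))) * MvPolynomial.X i).prod

/-- Hermite equivalence of two polynomials of the same degree `n`:
`[g](U X) = ± [f](X)` for some `U ∈ GLₙ(ℤ)`. -/
def HermiteEquiv (f g : ℤ[X]) : Prop :=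
  ∃ n : ℕ, f.natDegree = n ∧ g.natDegree = n ∧ ∃ U : GL (Fin n) ℤ,
    linSubst U.val (hermiteForm n g) = hermiteForm n f ∨
      linSubst U.val (hermiteForm n g) = -hermiteForm n f

theorem hermiteEquiv_equivalence : Equivalence HermiteEquiv where
  refl f := ⟨_, rfl, rfl, 1, Or.inl (by rw [Units.val_one, linSubst_one])⟩
  symm := by
    rintro f g ⟨n, hf, hg, U, h⟩
    have key : ∀ P : MvPolynomial (Fin n) ℂ,
        linSubst (U⁻¹).val (linSubst U.val P) = P := fun P => by
      rw [linSubst_linSubst, Units.mul_inv, linSubst_one]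
    refine ⟨n, hg, hf, U⁻¹, ?_⟩
    rcases h with h | h
    · exact Or.inl (by rw [← h, key])
    · refine Or.inr ?_
      rw [← neg_eq_iff_eq_neg.mpr h, map_neg, key]
  trans := by
    rintro f g k ⟨n, hf, hg, U, h⟩ ⟨m, hg', hk, V, h'⟩
    obtain rfl : n = m := hg.symm.trans hg'
    refine ⟨n, hf, hk, V * U, ?_⟩
    rw [Units.val_mul, ← linSubst_linSubst]
    rcases h with h | h <;> rcases h' with h' | h' <;> simp [h, h']

/-- The Hermite equivalence classes are the elements of `Quotient hermiteSetoid`. -/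
def hermiteSetoid : Setoid ℤ[X] := ⟨HermiteEquiv, hermiteEquiv_equivalence⟩

/-- `GL₂(ℤ)`-equivalence of two polynomials of the same degree `n`, with homogenizations
`F` and `G`: `G(X, Y) = ± F(a X + b Y, c X + d Y)` for some matrix in `GL₂(ℤ)`. -/
def GL2Equiv (f g : ℤ[X]) : Prop :=
  ∃ n : ℕ, f.natDegree = n ∧ g.natDegree = n ∧ ∃ γ : GL (Fin 2) ℤ,
    g.homogenize n = linSubst γ.val (f.homogenize n) ∨
      g.homogenize n = -linSubst γ.val (f.homogenize n)

/-- The polynomial `(X² - r)² - X - s`. -/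
noncomputable def quarticPoly (r s : ℤ) : ℤ[X] := (X ^ 2 - C r) ^ 2 - X - C s

/-- A sequence of pairs `(α m, β m)` of algebraic integers of `K` with
`ℚ(α m) = ℚ(β m) = K`, `β m = α m ^ 2 + r_m` and `α m = β m ^ 2 + s_m` for some integers
`r_m`, `s_m`, such that infinitely many distinct orders occur among the `ℤ[α m]`. -/
structure IsBEGSequence {K : Type*} [Field K] [NumberField K] (α β : ℕ → K) : Prop where
  integral_left : ∀ m, IsIntegral ℤ (α m)
  integral_right : ∀ m, IsIntegral ℤ (β m)
  adjoin_left : ∀ m, IntermediateField.adjoin ℚ {α m} = ⊤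
  adjoin_right : ∀ m, IntermediateField.adjoin ℚ {β m} = ⊤
  exists_right : ∀ m, ∃ r : ℤ, β m = α m ^ 2 + r
  exists_left : ∀ m, ∃ s : ℤ, α m = β m ^ 2 + s
  infinite_orders : (Set.range fun m => Algebra.adjoin ℤ {α m}).Infinite

/-!
Put `b = a ^ 2 - r` and `a = b ^ 2 - s`, so that `a` is a zero of `quarticPoly r s` and `b` a zero
of `quarticPoly s r`. Everything rests on the discriminant
`D(r, s) = 256 r² s² - 256 s³ - 256 r³ + 288 r s - 27` of `quarticPoly r s` (`quarticDisc`). It is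
odd, hence nonzero, and it takes each value only finitely often on integers
(`finite_quarticDisc_eq`): after exchanging `r` and `s` if necessary `|s| ≤ |r|`, and then the term
`256 r² (s² - r)` dominates unless `r = s²`, where `D = 32 s³ - 27`. So a set of pairs `(a, b)` in
`K` with finitely many discriminants is finite. The discriminant is determined by the order `ℤ[a]`
(`IsQuarticPair.quarticDisc_eq_of_adjoin_eq`) and also by the Hermite class of the minimal
polynomial (`IsQuarticPair.quarticDisc_eq_of_hermiteEquiv`): the form `[f]` is a product of linear
forms with a Vandermonde coefficient matrix, and by unique factorization a product of `n` linear
forms in `n` variables determines the square of that determinant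
(`det_sq_eq_of_prod_mulVec`). Hence finitely many Hermite classes would leave finitely many
pairs and finitely many orders, while infinitely many pairs give infinitely many orders.

To produce infinitely many pairs, number the conjugates `a₁, …, a₄` of `a`. They have sum `0`,
the sums `v_j = a₁ + a_j` are units with product `1`, and `2 a = v₂ + v₃ + v₄`,
`2 b = v₂ v₃ + v₂ v₄ + v₃ v₄`. Replacing every `v_j` by `v_j ^ 5` gives a new pair
(`IsQuarticPair.quintic`). A congruence modulo `2` keeps the conjugates distinct (`quinticElt_ne`),
and `max |r| |s|` grows strictly (`max_abs_lt_max_abs_quinticParam`).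

The minimal polynomials of `a` and `b` are Hermite equivalent because `1, a, a², a³` and
`1, b, b², b³` are bases of the same order (`IsQuarticPair.hermiteEquiv`). Since the Galois group is
`S₄`, the field `K` has no automorphism except the identity
(`eq_of_aeval_eq_zero_of_gal_equiv_perm`), so a `GL₂(ℤ)`-equivalence would make `a` a fractional
linear function of `b = a ^ 2 - r`, a relation of degree at most `3` for `a`
(`IsQuarticPair.not_gl2Equiv`).
-/

/-! ### The discriminant of `(X² - r)² - X - s` -/

/-- The discriminant of `(X ^ 2 - r) ^ 2 - X - s`. -/
def quarticDisc {R : Type*} [CommRing R] (r s : R) : R :=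
  256 * r ^ 2 * s ^ 2 - 256 * s ^ 3 - 256 * r ^ 3 + 288 * r * s - 27

theorem quarticDisc_comm (r s : ℤ) : quarticDisc s r = quarticDisc r s := by
  unfold quarticDisc; ring

theorem quarticDisc_ne_zero (r s : ℤ) : quarticDisc r s ≠ 0 := by
  -- the discriminant is odd
  unfold quarticDisc
  intro h
  have : 2 * (128 * r ^ 2 * s ^ 2 - 128 * s ^ 3 - 128 * r ^ 3 + 144 * r * s - 14) = -1 := by
    linear_combination h
  omega

/-- `quarticDisc r s` is the product of the squared differences of the zeros. -/
theorem prod_sq_sub_eq_quarticDisc {a b c d r s : ℂ}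
    (h : ∀ x : ℂ, (x - a) * (x - b) * (x - c) * (x - d) = (x ^ 2 - r) ^ 2 - x - s) :
    ((a - b) * (a - c) * (a - d) * (b - c) * (b - d) * (c - d)) ^ 2 = quarticDisc r s := by
  have h0 := h 0
  have h1 := h 1
  have h2 := h (-1)
  have h3 := h 2
  -- the coefficients are read off from divided differences at `-1, 0, 1, 2`
  obtain rfl : d = -(a + b + c) := by linear_combination -(h3 - 3 * h1 + 3 * h0 - h2) / 6
  have hr : r = -(a * b + a * c + b * c - (a + b + c) ^ 2) / 2 := by
    linear_combination (h1 - 2 * h0 + h2) / 4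
  have hs : s = r ^ 2 + a * b * c * (a + b + c) := by linear_combination h0
  have h3 : (a * b * c - (a * b + a * c + b * c) * (a + b + c)) = 1 := by
    linear_combination -(h1 - h2) / 2
  -- powers of the third elementary symmetric function, which is `1`, make the identity homogeneous
  have key : quarticDisc r s = 256 * r ^ 2 * s ^ 2 - 256 * s ^ 3
      - 256 * r ^ 3 * (a * b * c - (a * b + a * c + b * c) * (a + b + c)) ^ 2
      + 288 * r * s * (a * b * c - (a * b + a * c + b * c) * (a + b + c)) ^ 2
      - 27 * (a * b * c - (a * b + a * c + b * c) * (a + b + c)) ^ 4 := by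
    rw [h3]; unfold quarticDisc; ring
  rw [key, hs, hr]
  ring

/-- A lower bound for the discriminant when `|s| ≤ |r|` and `|r|` is large, coming from the term
`256 r² (s² - r)`. When `r = s²` that term vanishes, and the discriminant is `32 s³ - 27`. -/
theorem abs_le_abs_quarticDisc {r s : ℤ} (hsr : |s| ≤ |r|) (hr : 100 ≤ |r|) :
    |r| ≤ |quarticDisc r s| + 27 := by
  set D := quarticDisc r s with hD
  have hD' : D + 27 = 256 * (r ^ 2 * (s ^ 2 - r) - s ^ 3) + 288 * (r * s) := by
    rw [hD]; unfold quarticDisc; ring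
  have hD27 : |D + 27| ≤ |D| + 27 := abs_add_le D 27
  refine le_trans ?_ hD27
  rcases eq_or_ne (s ^ 2) r with hb | hb
  · have h32 : D + 27 = 32 * (s ^ 2 * s) := by rw [hD', ← hb]; ring
    have hs : 1 ≤ |s| := by
      refine Int.one_le_abs ?_
      rintro rfl
      simp [← hb] at hr
    rw [h32, ← hb, abs_mul, abs_mul, abs_pow]
    norm_num
    nlinarith [sq_nonneg s]
  have htri : 256 * (|r| ^ 2 * |s ^ 2 - r| - |s| ^ 3) - 288 * (|r| * |s|) ≤ |D + 27| := by
    rw [hD', ← abs_pow, ← abs_pow, ← abs_mul]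
    have h1 := abs_sub_abs_le_abs_sub (r ^ 2 * (s ^ 2 - r)) (s ^ 3)
    have h2 := abs_sub_abs_le_abs_sub (256 * (r ^ 2 * (s ^ 2 - r) - s ^ 3)) (-288 * (r * s))
    rw [abs_mul, abs_mul (-288) (r * s)] at h2
    norm_num at h2
    linarith
  refine le_trans ?_ htri
  have ht : 0 ≤ |s| := abs_nonneg s
  have hs2 := sq_abs s
  have hb1 : 1 ≤ |s ^ 2 - r| := Int.one_le_abs (sub_ne_zero.mpr hb)
  generalize |s| = t at *
  rw [← hs2] at hb1 ⊢
  rcases abs_cases r with ⟨hr', -⟩ | ⟨hr', -⟩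
  · rw [hr'] at hsr hr ⊢
    clear hr' htri hD27 hD' hD hb
    rcases abs_cases (t ^ 2 - r) with ⟨hβ, -⟩ | ⟨hβ, -⟩
    · rw [hβ] at hb1 ⊢
      obtain ⟨β, hβ'⟩ : ∃ β, t ^ 2 = r + β := ⟨t ^ 2 - r, by ring⟩
      rw [show t ^ 3 = t * t ^ 2 by ring, hβ', add_sub_cancel_left]
      rw [hβ', add_sub_cancel_left] at hb1
      -- for `β ≥ 3` the bound `t ≤ r` suffices; otherwise `t ^ 2 ≤ r + 2` makes `t` small
      rcases le_or_gt 3 β with h3 | h3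
      · nlinarith [mul_le_mul_of_nonneg_right hsr (show 0 ≤ r by linarith),
          mul_le_mul_of_nonneg_right hsr (show 0 ≤ β by linarith),
          mul_le_mul_of_nonneg_right h3 (show 0 ≤ r * (r - 1) by nlinarith)]
      · have ht5 : 5 * t ≤ r := by nlinarith
        nlinarith [mul_le_mul_of_nonneg_right hsr (show 0 ≤ β by linarith),
          mul_le_mul_of_nonneg_right hb1 (show 0 ≤ r * (r - 1) by nlinarith),
          mul_le_mul_of_nonneg_right ht5 (show 0 ≤ r by linarith)]
    · rw [hβ] at hb1 ⊢
      -- here `t ^ 2 < r`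
      have ht5 : 5 * t ≤ r := by nlinarith
      have h3 : t ^ 3 ≤ t * r := by nlinarith
      nlinarith [mul_le_mul_of_nonneg_right ht5 (show 0 ≤ r by linarith),
        mul_le_mul_of_nonneg_right hb1 (sq_nonneg r)]
  · obtain ⟨N, rfl⟩ : ∃ N, r = -N := ⟨-r, by ring⟩
    rw [neg_neg] at hr'
    rw [hr'] at hsr hr ⊢
    clear hr' htri hD27 hD' hD hb
    have h0 : 0 ≤ t ^ 2 + N := by positivity
    rw [sub_neg_eq_add, abs_of_nonneg h0]
    have h3 : t ^ 3 ≤ N ^ 2 * t ^ 2 := by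
      rw [show t ^ 3 = t * t ^ 2 by ring]
      exact mul_le_mul_of_nonneg_right (by nlinarith) (sq_nonneg t)
    nlinarith [mul_le_mul_of_nonneg_right hsr (show 0 ≤ N by linarith),
      mul_le_mul_of_nonneg_right hr (sq_nonneg N)]

theorem finite_quarticDisc_eq (c : ℤ) : {p : ℤ × ℤ | quarticDisc p.1 p.2 = c}.Finite := by
  refine ((Set.finite_Icc (-(|c| + 127)) (|c| + 127)).prod
    (Set.finite_Icc (-(|c| + 127)) (|c| + 127))).subset ?_
  rintro ⟨r, s⟩ h
  have h : quarticDisc r s = c := h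
  have hc : 0 ≤ |c| := abs_nonneg c
  have key : |r| ≤ |c| + 127 ∧ |s| ≤ |c| + 127 := by
    rcases le_total |s| |r| with hsr | hsr
    · have : |r| ≤ |c| + 127 := by
        by_cases hr : 100 ≤ |r|
        · have := abs_le_abs_quarticDisc hsr hr
          rw [h] at this; linarith
        · linarith
      exact ⟨this, hsr.trans this⟩
    · have : |s| ≤ |c| + 127 := by
        by_cases hr : 100 ≤ |s|
        · have := abs_le_abs_quarticDisc hsr hr
          rw [quarticDisc_comm, h] at this; linarith
        · linarith
      exact ⟨hsr.trans this, this⟩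
  exact ⟨abs_le.mp key.1, abs_le.mp key.2⟩

/-! ### The quintic step -/

/-- If `2 a = v₁ + v₂ + v₃`, `2 b = v₁ v₂ + v₁ v₃ + v₂ v₃` and `v₁ v₂ v₃ = 1`, then
`2 * quinticElt a b = v₁ ^ 5 + v₂ ^ 5 + v₃ ^ 5`. -/
def quinticElt {R : Type*} [CommRing R] (a b : R) : R :=
  16 * a ^ 5 - 40 * a ^ 3 * b + 20 * a * b ^ 2 + 10 * a ^ 2 - 5 * b

/-- If `4 r` and `4 s` are the first two elementary symmetric functions of `w₁, w₂, w₃` and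
`w₁ w₂ w₃ = 1`, then `4 * quinticParam r s = w₁ ^ 5 + w₂ ^ 5 + w₃ ^ 5`. -/
def quinticParam {R : Type*} [CommRing R] (r s : R) : R :=
  256 * r ^ 5 - 320 * r ^ 3 * s + 80 * r * s ^ 2 + 20 * r ^ 2 - 5 * s

theorem map_quinticElt {R S : Type*} [CommRing R] [CommRing S] (φ : R →+* S) (a b : R) :
    φ (quinticElt a b) = quinticElt (φ a) (φ b) := by
  simp [quinticElt, map_ofNat]

theorem quinticElt_relation {R : Type*} [CommRing R] {a b r s : R} (hb : b = a ^ 2 - r)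
    (ha : a = b ^ 2 - s) : quinticElt b a = quinticElt a b ^ 2 - quinticParam r s := by
  obtain rfl : a ^ 2 - b = r := by linear_combination -hb
  obtain rfl : b ^ 2 - a = s := by linear_combination -ha
  unfold quinticElt quinticParam
  ring

/-- The excluded parameters are a genuine exception: `quinticParam (-1) 1 = -1`. -/
theorem abs_lt_abs_quinticParam {r s : ℤ} (hsr : |s| ≤ |r|) (hr : r ≠ 0)
    (hrs : ¬ (r = -1 ∧ s = 1)) :
    |r| < |quinticParam r s| := by
  have h1 : 1 ≤ |r| := Int.one_le_abs hr
  rcases h1.eq_or_lt with h1 | h1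
  · rw [← h1] at hsr ⊢
    have hr1 := (abs_eq (zero_le_one (α := ℤ))).mp h1.symm
    clear h1 hr
    have hs := abs_le.mp hsr
    obtain ⟨hs1, hs2⟩ := hs
    rcases hr1 with rfl | rfl <;> interval_cases s <;>
      first | exact absurd ⟨rfl, rfl⟩ hrs | norm_num [quinticParam]
  have htri : 256 * |r| ^ 5 ≤ |quinticParam r s|
      + (320 * (|r| ^ 3 * |s|) + 80 * (|r| * |s| ^ 2) + 20 * |r| ^ 2 + 5 * |s|) := by
    have h2 : 256 * r ^ 5 = quinticParam r s +
        (320 * (r ^ 3 * s) + -(80 * (r * s ^ 2)) + -(20 * r ^ 2) + 5 * s) := by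
      unfold quinticParam; ring
    have h3 := abs_add_le (quinticParam r s)
      (320 * (r ^ 3 * s) + -(80 * (r * s ^ 2)) + -(20 * r ^ 2) + 5 * s)
    have h4 := abs_add_le (320 * (r ^ 3 * s) + -(80 * (r * s ^ 2)) + -(20 * r ^ 2)) (5 * s)
    have h5 := abs_add_le (320 * (r ^ 3 * s) + -(80 * (r * s ^ 2))) (-(20 * r ^ 2))
    have h6 := abs_add_le (320 * (r ^ 3 * s)) (-(80 * (r * s ^ 2)))
    rw [← h2] at h3
    simp only [abs_neg, abs_mul, abs_pow] at h3 h4 h5 h6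
    norm_num at h3 h4 h5 h6
    rw [sq_abs, sq_abs]
    linarith
  have ht : 0 ≤ |s| := abs_nonneg s
  generalize |quinticParam r s| = Q at *
  generalize |s| = t at *
  generalize |r| = N at *
  have h7 : N ^ 3 * t ≤ N ^ 3 * N := mul_le_mul_of_nonneg_left hsr (by positivity)
  have h8 : N * t ^ 2 ≤ N * N ^ 2 :=
    mul_le_mul_of_nonneg_left (pow_le_pow_left₀ ht hsr 2) (by positivity)
  obtain ⟨k, rfl⟩ : ∃ k, N = k + 2 := ⟨N - 2, by ring⟩
  have hk : 0 ≤ k := by linarith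
  have h9 : 0 < 256 * (k + 2) ^ 5 - 320 * ((k + 2) ^ 3 * (k + 2)) - 80 * ((k + 2) * (k + 2) ^ 2)
      - 20 * (k + 2) ^ 2 - 6 * (k + 2) := by
    ring_nf
    positivity
  linarith

theorem max_abs_lt_max_abs_quinticParam {r s : ℤ} (h : ¬ (r = 0 ∧ s = 0)) :
    max |r| |s| < max |quinticParam r s| |quinticParam s r| := by
  by_cases h1 : r = -1 ∧ s = 1
  · obtain ⟨rfl, rfl⟩ := h1
    norm_num [quinticParam]
  by_cases h2 : s = -1 ∧ r = 1
  · obtain ⟨rfl, rfl⟩ := h2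
    norm_num [quinticParam]
  rcases le_total |s| |r| with hsr | hsr
  · have hr : r ≠ 0 := by
      rintro rfl
      exact h ⟨rfl, by simpa using hsr⟩
    rw [max_eq_left hsr]
    exact lt_max_of_lt_left (abs_lt_abs_quinticParam hsr hr h1)
  · have hs : s ≠ 0 := by
      rintro rfl
      exact h ⟨by simpa using hsr, rfl⟩
    rw [max_eq_right hsr]
    exact lt_max_of_lt_right (abs_lt_abs_quinticParam hsr hs h2)

/-- The difference of two conjugates after the quintic step. With `p = a - c` and `q = b + d` it is
`p (p ^ 4 - 5 p ^ 2 q + 5 q ^ 2)`, rewritten by means of `p ^ 2 = q + 2 (r - a c)`. -/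
theorem quinticElt_sub {F : Type*} [Field F] [CharZero F] {a b c d r s : F} (hb : b = a ^ 2 - r)
    (ha : a = b ^ 2 - s) (hd : d = c ^ 2 - r) (hc : c = d ^ 2 - s) (hac : a ≠ c) :
    (a + c) * (b + d) = 1 ∧ quinticElt a b - quinticElt c d = (a - c) *
      ((b + d) ^ 2 + 2 * (2 * (r - a * c) ^ 2 - 3 * (r - a * c) * (b + d))) := by
  have h1 : (a + c) * (b + d) = 1 := by
    have : (a - c) * ((a + c) * (b + d) - 1) = 0 := by
      linear_combination (-(b + d)) * hb + (b + d) * hd - ha + hc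
    have := (mul_eq_zero.mp this).resolve_left (sub_ne_zero.mpr hac)
    linear_combination this
  refine ⟨h1, ?_⟩
  obtain rfl : a ^ 2 - b = r := by linear_combination -hb
  obtain ⟨u, rfl⟩ : ∃ u, c = u - a := ⟨a + c, by ring⟩
  have hu : u ≠ 0 := by rintro rfl; simp at h1
  have hd' : d = u⁻¹ - b := by
    field_simp
    linear_combination h1
  have hb' : b = (u⁻¹ + (2 * a - u) * u) / 2 := by
    linear_combination (hd' - hd) / 2
  rw [hd', hb']
  unfold quinticElt
  field_simp
  ring

/-- The quintic step separates conjugates. With `q = b + d`, the second factor of the difference in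
`quinticElt_sub` is congruent to `q ^ 2` modulo `2`; as `q` is a unit, it does not vanish. -/
theorem quinticElt_ne {F : Type*} [Field F] [CharZero F] {a b c d : F} {r s : ℤ}
    (hb : b = a ^ 2 - r)
    (ha : a = b ^ 2 - s) (hd : d = c ^ 2 - r) (hc : c = d ^ 2 - s) (hac : a ≠ c)
    (ia : IsIntegral ℤ a) (ic : IsIntegral ℤ c) :
    quinticElt a b ≠ quinticElt c d := by
  obtain ⟨h1, h2⟩ := quinticElt_sub hb ha hd hc hac
  have ir : IsIntegral ℤ (r : F) := isIntegral_algebraMap (R := ℤ) (A := F) (x := r)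
  have ib : IsIntegral ℤ b := by rw [hb]; exact (ia.pow 2).sub ir
  have id : IsIntegral ℤ d := by rw [hd]; exact (ic.pow 2).sub ir
  intro h
  rw [h, sub_self] at h2
  have h3 := (mul_eq_zero.mp h2.symm).resolve_left (sub_ne_zero.mpr hac)
  -- if the factor vanished, `2` would divide the unit `(b + d) ^ 2` with inverse `(a + c) ^ 2`
  have h4 : IsIntegral ℤ ((1 / 2 : ℚ) : F) := by
    have : ((1 / 2 : ℚ) : F) =
        (a + c) ^ 2 * (3 * ((r - a * c) * (b + d)) - 2 * (r - a * c) ^ 2) := by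
      push_cast
      linear_combination (a + c) ^ 2 / 2 * h3 - ((a + c) * (b + d) + 1) / 2 * h1
    have i3 : IsIntegral ℤ (3 : F) := by
      simpa using isIntegral_algebraMap (R := ℤ) (A := F) (x := 3)
    have i2 : IsIntegral ℤ (2 : F) := by
      simpa using isIntegral_algebraMap (R := ℤ) (A := F) (x := 2)
    rw [this]
    have it := ir.sub (ia.mul ic)
    exact ((ia.add ic).pow 2).mul ((i3.mul (it.mul (ib.add id))).sub (i2.mul (it.pow 2)))
  have h5 : IsIntegral ℤ (1 / 2 : ℚ) :=
    (isIntegral_algebraMap_iff (algebraMap ℚ F).injective).mp h4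
  obtain ⟨n, hn⟩ := IsIntegrallyClosed.isIntegral_iff.mp h5
  have h6 : (2 * n : ℚ) = 1 := by
    have : (n : ℚ) = 1 / 2 := hn
    rw [this]; norm_num
  norm_cast at h6
  omega

/-! ### Products of linear forms -/

/-- If a product of `n` linear forms in `n` variables is `±` the product of the variables, then by
unique factorization the forms are multiples of the variables, and the multipliers have product
`± 1`. -/
theorem det_sq_eq_one_of_prod_mulVec {n : ℕ} {M : Matrix (Fin n) (Fin n) ℂ} {ε : ℂ}
    (hε : ε ^ 2 = 1)
    (h : ∀ y : Fin n → ℂ, ∏ i, (M.mulVec y) i = ε * ∏ i, y i) : M.det ^ 2 = 1 := by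
  have hε0 : ε ≠ 0 := by rintro rfl; simp at hε
  have hpoly : ∏ i, (∑ j, MvPolynomial.C (M i j) * MvPolynomial.X j) =
      MvPolynomial.C ε * ∏ j : Fin n, (MvPolynomial.X j : MvPolynomial (Fin n) ℂ) := by
    apply MvPolynomial.funext
    intro y
    simpa [Matrix.mulVec, dotProduct] using h y
  have hdvd : ∀ j, ∃ i, (MvPolynomial.X j : MvPolynomial (Fin n) ℂ) ∣
      ∑ k, MvPolynomial.C (M i k) * MvPolynomial.X k := by
    intro j
    have h1 : (MvPolynomial.X j : MvPolynomial (Fin n) ℂ) ∣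
        ∏ i, (∑ k, MvPolynomial.C (M i k) * MvPolynomial.X k) := by
      rw [hpoly]
      exact (Finset.dvd_prod_of_mem _ (Finset.mem_univ j)).mul_left _
    obtain ⟨i, -, hi⟩ := (MvPolynomial.X_prime.dvd_finsetProd_iff _).mp h1
    exact ⟨i, hi⟩
  choose π hπ using hdvd
  -- the form divisible by `X j` is a multiple of `X j`
  have hentry : ∀ j k, k ≠ j → M (π j) k = 0 := by
    intro j k hkj
    obtain ⟨q, hq⟩ := hπ j
    have := congrArg (MvPolynomial.eval (Pi.single k (1 : ℂ))) hq
    simpa [Pi.single_apply, hkj, hkj.symm] using this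
  have hrow : ∀ y j, (M.mulVec y) (π j) = M (π j) j * y j := by
    intro y j
    rw [Matrix.mulVec, dotProduct, Finset.sum_eq_single j]
    · intro k _ hk
      rw [hentry j k hk, zero_mul]
    · simp
  have hπinj : Function.Injective π := by
    intro j j' hjj
    by_contra hne
    have h1 := h 1
    have h2 := hrow 1 j
    rw [hjj, hentry j' j hne, zero_mul] at h2
    rw [Finset.prod_eq_zero (Finset.mem_univ (π j')) h2] at h1
    simp at h1
    exact hε0 h1.symm
  let σ : Equiv.Perm (Fin n) := Equiv.ofBijective π (Finite.injective_iff_bijective.mp hπinj)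
  have hM : M.submatrix σ id = Matrix.diagonal fun j => M (π j) j := by
    ext j k
    rcases eq_or_ne k j with rfl | hk
    · simp [σ]
    · simp [σ, hentry j k hk, Matrix.diagonal_apply_ne' _ hk]
  have hprod : ∏ j, M (π j) j = ε := by
    have h1 := h 1
    rw [← Equiv.prod_comp σ] at h1
    simpa [σ, hrow] using h1
  have hdet := congrArg Matrix.det hM
  rw [Matrix.det_permute, Matrix.det_diagonal, hprod] at hdet
  rw [← hε, ← hdet, mul_pow, ← Int.cast_pow, ← Units.val_pow_eq_pow_val, Int.units_sq]
  simp

theorem det_sq_eq_of_prod_mulVec {n : ℕ} {A B : Matrix (Fin n) (Fin n) ℂ}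
    (hB : B.det ≠ 0) (U : GL (Fin n) ℤ) {ε : ℂ} (hε : ε ^ 2 = 1)
    (h : ∀ x : Fin n → ℂ, ∏ i, (A.mulVec ((U.val.map (Int.castRingHom ℂ)).mulVec x)) i
      = ε * ∏ i, (B.mulVec x) i) : A.det ^ 2 = B.det ^ 2 := by
  have hu : IsUnit B.det := isUnit_iff_ne_zero.mpr hB
  have h1 : (A * U.val.map (Int.castRingHom ℂ) * B⁻¹).det ^ 2 = 1 := by
    refine det_sq_eq_one_of_prod_mulVec hε fun y => ?_
    have := h (B⁻¹.mulVec y)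
    simpa [Matrix.mulVec_mulVec, Matrix.mul_nonsing_inv B hu, ← Matrix.mul_assoc] using this
  have hU : (U.val.map (Int.castRingHom ℂ)).det ^ 2 = 1 := by
    rw [← RingHom.mapMatrix_apply, ← RingHom.map_det, ← map_pow]
    have : IsUnit U.val.det := (Matrix.isUnit_iff_isUnit_det _).mp U.isUnit
    rw [Int.isUnit_sq this, map_one]
  rw [Matrix.det_mul, Matrix.det_mul, mul_pow, mul_pow, hU, mul_one, ← mul_pow,
    Matrix.det_nonsing_inv, Ring.inverse_eq_inv', ← div_eq_mul_inv, div_pow,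
    div_eq_one_iff_eq (pow_ne_zero 2 hB)] at h1
  exact h1

theorem eval_linSubst {n : ℕ} (U : Matrix (Fin n) (Fin n) ℤ) (P : MvPolynomial (Fin n) ℂ)
    (x : Fin n → ℂ) :
    MvPolynomial.eval x (linSubst U P) =
      MvPolynomial.eval ((U.map (Int.castRingHom ℂ)).mulVec x) P := by
  induction P using MvPolynomial.induction_on with
  | C a => simp [linSubst]
  | add p q hp hq => simp [hp, hq]
  | mul_X p i hp =>
    rw [map_mul, map_mul, map_mul, hp]
    simp [linSubst, Matrix.mulVec, dotProduct]

/-! ### Embeddings and the conjugates of a generator -/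

section Conjugates

variable {K : Type*} [Field K] [NumberField K]

theorem natDegree_minpoly_int {α : K} (hα : IsIntegral ℤ α)
    (htop : IntermediateField.adjoin ℚ {α} = ⊤) :
    (minpoly ℤ α).natDegree = Module.finrank ℚ K := by
  rw [← (Field.primitive_element_iff_minpoly_natDegree_eq ℚ α).mp htop,
    minpoly.isIntegrallyClosed_eq_field_fractions' ℚ hα, (minpoly.monic hα).natDegree_map]

/-- The complex roots of the minimal polynomial of a generator are its images under embeddings. -/
theorem roots_map_minpoly_of_adjoin_eq_top {α : K} (hα : IsIntegral ℤ α)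
    (htop : IntermediateField.adjoin ℚ {α} = ⊤) :
    ((minpoly ℤ α).map (Int.castRingHom ℂ)).roots =
      (Finset.univ : Finset (K →ₐ[ℚ] ℂ)).val.map fun σ => σ α := by
  have hne : (minpoly ℤ α).map (Int.castRingHom ℂ) ≠ 0 :=
    ((minpoly.monic hα).map _).ne_zero
  have hinj : Function.Injective fun σ : K →ₐ[ℚ] ℂ => σ α :=
    (Field.primitive_element_iff_algHom_eq_of_eval' ℚ ℂ
      (fun x => IsAlgClosed.splits _) α).mp htop
  have hnd : ((Finset.univ : Finset (K →ₐ[ℚ] ℂ)).val.map fun σ => σ α).Nodup :=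
    Multiset.Nodup.map hinj Finset.univ.nodup
  refine (Multiset.eq_of_le_of_card_le ((Multiset.le_iff_subset hnd).mpr ?_) ?_).symm
  · intro z hz
    obtain ⟨σ, -, rfl⟩ := Multiset.mem_map.mp hz
    rw [mem_roots hne, IsRoot, eval_map,
      Subsingleton.elim (Int.castRingHom ℂ) (σ.toRingHom.comp (algebraMap ℤ K))]
    change eval₂ _ (σ.toRingHom α) _ = 0
    rw [← hom_eval₂, ← aeval_def, minpoly.aeval, map_zero]
  · rw [Multiset.card_map, Finset.card_val, Finset.card_univ, AlgHom.card,
      ← natDegree_minpoly_int hα htop]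
    exact (card_roots' _).trans natDegree_map_le

/-- For a generator of a field of degree `n`, the factors of the form `[f]` of its minimal
polynomial are indexed by the complex embeddings. -/
theorem eval_hermiteForm_minpoly {n : ℕ} (e : Fin n ≃ (K →ₐ[ℚ] ℂ)) {α : K} (hα : IsIntegral ℤ α)
    (htop : IntermediateField.adjoin ℚ {α} = ⊤) (x : Fin n → ℂ) :
    MvPolynomial.eval x (hermiteForm n (minpoly ℤ α)) =
      ∏ i, ((Matrix.projVandermonde 1 fun i => e i α).mulVec x) i := by
  rw [hermiteForm, (minpoly.monic hα).leadingCoeff, roots_map_minpoly_of_adjoin_eq_top hα htop,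
    Multiset.map_map, map_mul]
  simp only [Int.cast_one, one_pow, map_one, one_mul]
  change MvPolynomial.eval x (∏ σ : K →ₐ[ℚ] ℂ, _) = _
  rw [map_prod, ← Equiv.prod_comp e]
  refine Finset.prod_congr rfl fun i _ => ?_
  simp [Matrix.mulVec, dotProduct, Matrix.projVandermonde_apply, Fin.val_rev, Nat.sub_sub,
    add_comm]

end Conjugates

/-! ### Pairs in a quartic field -/

theorem natDegree_quarticPoly (r s : ℤ) : (quarticPoly r s).natDegree = 4 := by
  unfold quarticPoly; compute_degree!

theorem monic_quarticPoly (r s : ℤ) : (quarticPoly r s).Monic := by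
  unfold quarticPoly; monicity!

/-- An integral generator `α` of `K` with `β = α ^ 2 - r` and `α = β ^ 2 - s`. The signs of `r` and
`s` are those of `quarticPoly r s`, which vanishes at `α`; they are opposite to those in
`IsBEGSequence`. -/
structure IsQuarticPair {K : Type*} [Field K] [NumberField K] (r s : ℤ) (α β : K) : Prop where
  integral : IsIntegral ℤ α
  adjoin_eq_top : IntermediateField.adjoin ℚ {α} = ⊤
  right_eq : β = α ^ 2 - r
  left_eq : α = β ^ 2 - s

namespace IsQuarticPair

variable {K : Type*} [Field K] [NumberField K] {r s r' s' : ℤ} {α β α' β' : K}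

theorem symm (h : IsQuarticPair r s α β) : IsQuarticPair s r β α where
  integral := by
    rw [h.right_eq]
    exact (h.integral.pow 2).sub (isIntegral_algebraMap (R := ℤ) (A := K) (x := r))
  adjoin_eq_top := by
    rw [eq_top_iff, ← h.adjoin_eq_top, IntermediateField.adjoin_simple_le_iff]
    have hβ := IntermediateField.mem_adjoin_simple_self ℚ β
    have hs : (s : K) ∈ IntermediateField.adjoin ℚ {β} := intCast_mem _ s
    rw [h.left_eq]
    exact sub_mem (pow_mem hβ 2) hs
  right_eq := h.left_eq
  left_eq := h.right_eq

theorem aeval_quarticPoly (h : IsQuarticPair r s α β) : aeval α (quarticPoly r s) = 0 := by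
  have h1 := h.right_eq
  have h2 := h.left_eq
  simp only [quarticPoly, map_sub, map_pow, aeval_X, eq_intCast, map_intCast]
  rw [← h1]
  linear_combination -h2

theorem minpoly_eq (h : IsQuarticPair r s α β) (hK : Module.finrank ℚ K = 4) :
    minpoly ℤ α = quarticPoly r s := by
  refine (eq_of_monic_of_dvd_of_natDegree_le (minpoly.monic h.integral) (monic_quarticPoly r s)
    (minpoly.isIntegrallyClosed_dvd h.integral h.aeval_quarticPoly) ?_).symm
  rw [natDegree_minpoly_int h.integral h.adjoin_eq_top, hK, natDegree_quarticPoly]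

theorem det_projVandermonde_sq (h : IsQuarticPair r s α β) (hK : Module.finrank ℚ K = 4)
    (e : Fin 4 ≃ (K →ₐ[ℚ] ℂ)) :
    (Matrix.projVandermonde 1 fun i => e i α).det ^ 2 = ((quarticDisc r s : ℤ) : ℂ) := by
  have hroots := roots_map_minpoly_of_adjoin_eq_top h.integral h.adjoin_eq_top
  rw [h.minpoly_eq hK] at hroots
  have hprod := (IsAlgClosed.splits
    ((quarticPoly r s).map (Int.castRingHom ℂ))).eq_prod_roots_of_monic
      ((monic_quarticPoly r s).map _)
  rw [hroots, Multiset.map_map] at hprod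
  change _ = ∏ σ : K →ₐ[ℚ] ℂ, (X - C (σ α)) at hprod
  rw [← Equiv.prod_comp e, Fin.prod_univ_four] at hprod
  have hx : ∀ x : ℂ, (x - e 0 α) * (x - e 1 α) * (x - e 2 α) * (x - e 3 α) =
      (x ^ 2 - r) ^ 2 - x - s := by
    intro x
    have := congrArg (eval x) hprod
    simpa [quarticPoly] using this.symm
  have hcast : ((quarticDisc r s : ℤ) : ℂ) = quarticDisc (r : ℂ) s := by
    simp [quarticDisc]
  rw [hcast, ← prod_sq_sub_eq_quarticDisc hx, Matrix.det_projVandermonde]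
  have h0 : (Finset.Ioi 0 : Finset (Fin 4)) = {1, 2, 3} := rfl
  have h1 : (Finset.Ioi 1 : Finset (Fin 4)) = {2, 3} := rfl
  have h2 : (Finset.Ioi 2 : Finset (Fin 4)) = {3} := rfl
  have h3 : (Finset.Ioi 3 : Finset (Fin 4)) = ∅ := rfl
  simp [Fin.prod_univ_four, h0, h1, h2, h3]
  ring

theorem det_projVandermonde_ne_zero (h : IsQuarticPair r s α β) (hK : Module.finrank ℚ K = 4)
    (e : Fin 4 ≃ (K →ₐ[ℚ] ℂ)) : (Matrix.projVandermonde 1 fun i => e i α).det ≠ 0 := by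
  intro h0
  have := h.det_projVandermonde_sq hK e
  rw [h0, zero_pow two_ne_zero] at this
  exact quarticDisc_ne_zero r s (by exact_mod_cast this.symm)

theorem exists_equiv_embeddings (hK : Module.finrank ℚ K = 4) :
    Nonempty (Fin 4 ≃ (K →ₐ[ℚ] ℂ)) :=
  ⟨(Fintype.equivFinOfCardEq ((AlgHom.card ℚ K ℂ).trans hK)).symm⟩

/-- Hermite equivalent minimal polynomials have the same discriminant, the squared determinant of
the coefficient matrix of the linear factors of the Hermite form. -/
theorem quarticDisc_eq_of_hermiteEquiv (h : IsQuarticPair r s α β) (h' : IsQuarticPair r' s' α' β')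
    (hK : Module.finrank ℚ K = 4) (hH : HermiteEquiv (minpoly ℤ α) (minpoly ℤ α')) :
    quarticDisc r s = quarticDisc r' s' := by
  obtain ⟨e⟩ := exists_equiv_embeddings hK
  obtain ⟨n, hn, -, U, hU⟩ := hH
  obtain rfl : 4 = n := by rw [← hn, h.minpoly_eq hK, natDegree_quarticPoly]
  have key : ∃ ε : ℂ, ε ^ 2 = 1 ∧ ∀ x,
      MvPolynomial.eval x (linSubst U.val (hermiteForm 4 (minpoly ℤ α'))) =
        ε * MvPolynomial.eval x (hermiteForm 4 (minpoly ℤ α)) := by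
    rcases hU with hU | hU
    · exact ⟨1, by norm_num, fun x => by rw [hU, one_mul]⟩
    · exact ⟨-1, by norm_num, fun x => by rw [hU, map_neg, neg_one_mul]⟩
  obtain ⟨ε, hε, hx⟩ := key
  simp only [eval_linSubst, eval_hermiteForm_minpoly e h.integral h.adjoin_eq_top,
    eval_hermiteForm_minpoly e h'.integral h'.adjoin_eq_top] at hx
  have := det_sq_eq_of_prod_mulVec (h.det_projVandermonde_ne_zero hK e) U hε hx
  rw [h.det_projVandermonde_sq hK, h'.det_projVandermonde_sq hK] at this
  exact_mod_cast this.symm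

theorem hermiteEquiv (h : IsQuarticPair r s α β) (hK : Module.finrank ℚ K = 4) :
    HermiteEquiv (minpoly ℤ α) (minpoly ℤ β) := by
  obtain ⟨e⟩ := exists_equiv_embeddings hK
  -- column `j` holds the coordinates of `α ^ (3 - j)` in the basis `β ^ 3, β ^ 2, β, 1`
  let U : Matrix (Fin 4) (Fin 4) ℤ :=
    !![1, 0, 0, 0; r, 0, 1, 0; -s, 1, 0, 0; -(r * s), r, -s, 1]
  have hdet : U.det = -1 := by
    simp [U, Matrix.det_succ_row_zero, Fin.sum_univ_succ, Fin.succAbove]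
  refine ⟨4, by rw [h.minpoly_eq hK, natDegree_quarticPoly],
    by rw [h.symm.minpoly_eq hK, natDegree_quarticPoly],
    Matrix.GeneralLinearGroup.mk'' U (by rw [hdet]; exact isUnit_one.neg), Or.inl ?_⟩
  apply MvPolynomial.funext
  intro x
  rw [eval_linSubst, eval_hermiteForm_minpoly e h.integral h.adjoin_eq_top,
    eval_hermiteForm_minpoly e h.symm.integral h.symm.adjoin_eq_top]
  refine Finset.prod_congr rfl fun i _ => ?_
  change Matrix.mulVec _ (Matrix.mulVec (U.map (Int.castRingHom ℂ)) x) i = _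
  rw [Matrix.mulVec_mulVec]
  refine congrFun (congrArg (fun M => Matrix.mulVec M x) ?_) i
  ext k j
  have hβ : e k β = e k α ^ 2 - r := by rw [h.right_eq]; simp
  have hα : e k α = e k β ^ 2 - s := by
    conv_lhs => rw [h.left_eq]
    simp
  rw [Matrix.mul_apply, Fin.sum_univ_four]
  simp only [Matrix.projVandermonde_apply]
  generalize e k α = a at *
  generalize e k β = b at *
  fin_cases j
  · simp [U]
    linear_combination (b ^ 2 - s) * hβ - a ^ 2 * hα
  · simp [U]
    linear_combination hβ
  · simp [U]
    linear_combination -hα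
  · simp [U]

/-- For `x ∈ ℤ[α]`, the integral coordinates of the powers of `x` in the powers of `α` relate the two
Vandermonde determinants. -/
theorem exists_det_eq_mul_of_mem_adjoin (h : IsQuarticPair r s α β)
    (hK : Module.finrank ℚ K = 4) (e : Fin 4 ≃ (K →ₐ[ℚ] ℂ))
    {x : K} (hx : x ∈ Algebra.adjoin ℤ {α}) :
    ∃ m : ℤ, (Matrix.projVandermonde 1 fun i => e i x).det =
      (Matrix.projVandermonde 1 fun i => e i α).det * m := by
  have hcoord : ∀ y ∈ Algebra.adjoin ℤ {α}, ∃ c : Fin 4 → ℤ,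
      y = ∑ j : Fin 4, (c j : K) * α ^ (j.rev : ℕ) := by
    intro y hy
    rw [Algebra.adjoin_singleton_eq_range_aeval] at hy
    obtain ⟨p, rfl⟩ := hy
    have hm := minpoly.monic h.integral
    have hdeg : (p %ₘ minpoly ℤ α).natDegree < 4 := by
      have h4 : (minpoly ℤ α).natDegree = 4 := by rw [h.minpoly_eq hK, natDegree_quarticPoly]
      refine (natDegree_modByMonic_lt p hm ?_).trans_eq h4
      intro h1
      rw [h1] at h4
      simp at h4
    refine ⟨fun j => (p %ₘ minpoly ℤ α).coeff j.rev, ?_⟩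
    change aeval α p = _
    rw [← aeval_modByMonic_eq_self_of_root (minpoly.aeval ℤ α), aeval_eq_sum_range' hdeg,
      ← Fin.sum_univ_eq_sum_range (fun i => (p %ₘ minpoly ℤ α).coeff i • α ^ i),
      ← Equiv.sum_comp Fin.revPerm]
    simp
  choose c hc using fun k : Fin 4 => hcoord (x ^ (k.rev : ℕ)) (pow_mem hx _)
  refine ⟨(Matrix.of c).transpose.det, ?_⟩
  have hmat : (Matrix.projVandermonde 1 fun i => e i x) =
      (Matrix.projVandermonde 1 fun i => e i α) *
        (Matrix.of c).transpose.map (Int.castRingHom ℂ) := by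
    ext i k
    have := congrArg (e i) (hc k)
    simp only [map_pow, map_sum, map_mul, map_intCast] at this
    simp only [Matrix.projVandermonde_apply, Matrix.mul_apply, this, Pi.one_apply, one_pow, one_mul,
      Matrix.map_apply, Matrix.transpose_apply, Matrix.of_apply, eq_intCast, mul_comm]
  rw [hmat, Matrix.det_mul, ← RingHom.mapMatrix_apply, ← RingHom.map_det, eq_intCast]

/-- The discriminant of the minimal polynomial of `α` depends only on the order `ℤ[α]`. -/
theorem quarticDisc_eq_of_adjoin_eq (h : IsQuarticPair r s α β) (h' : IsQuarticPair r' s' α' β')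
    (hK : Module.finrank ℚ K = 4) (hO : Algebra.adjoin ℤ {α} = Algebra.adjoin ℤ {α'}) :
    quarticDisc r s = quarticDisc r' s' := by
  obtain ⟨e⟩ := exists_equiv_embeddings hK
  obtain ⟨m, hm⟩ := h.exists_det_eq_mul_of_mem_adjoin hK e
    (hO ▸ Algebra.self_mem_adjoin_singleton ℤ α')
  obtain ⟨m', hm'⟩ := h'.exists_det_eq_mul_of_mem_adjoin hK e
    (hO ▸ Algebra.self_mem_adjoin_singleton ℤ α)
  have h1 : (m : ℂ) * m' = 1 := by
    rw [hm, mul_assoc] at hm'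
    exact (mul_eq_left₀ (h.det_projVandermonde_ne_zero hK e)).mp hm'.symm
  have h2 : IsUnit m := IsUnit.of_mul_eq_one m' (by exact_mod_cast h1)
  have h3 := h'.det_projVandermonde_sq hK e
  rw [hm, mul_pow, h.det_projVandermonde_sq hK, ← Int.cast_pow, Int.isUnit_sq h2, Int.cast_one,
    mul_one] at h3
  exact_mod_cast h3

/-- Only finitely many generators belong to a finite set of discriminants. -/
theorem finite_range_of_finite_range_quarticDisc {ι : Type*} {r s : ι → ℤ} {α β : ι → K}
    (h : ∀ m, IsQuarticPair (r m) (s m) (α m) (β m))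
    (hD : (Set.range fun m => quarticDisc (r m) (s m)).Finite) :
    (Set.range fun m => (α m, β m)).Finite := by
  have hrs : {p : ℤ × ℤ | quarticDisc p.1 p.2 ∈
      Set.range fun m => quarticDisc (r m) (s m)}.Finite :=
    hD.preimage' fun c _ => finite_quarticDisc_eq c
  have hroot : (⋃ p ∈ {p : ℤ × ℤ | quarticDisc p.1 p.2 ∈
      Set.range fun m => quarticDisc (r m) (s m)},
      (fun x : K => (x, x ^ 2 - (p.1 : K))) '' (quarticPoly p.1 p.2).rootSet K).Finite :=
    hrs.biUnion fun p _ => (rootSet_finite _ _).image _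
  refine hroot.subset ?_
  rintro _ ⟨m, rfl⟩
  refine Set.mem_biUnion (x := (r m, s m)) ⟨m, rfl⟩ ⟨α m, ?_, ?_⟩
  · exact mem_rootSet.mpr ⟨(monic_quarticPoly _ _).ne_zero, (h m).aeval_quarticPoly⟩
  · exact Prod.ext rfl (h m).right_eq.symm

/-- The quintic step leads from a pair to another pair with new parameters. -/
theorem quintic (h : IsQuarticPair r s α β) :
    IsQuarticPair (quinticParam r s) (quinticParam s r) (quinticElt α β) (quinticElt β α) where
  integral := by
    have hα : α ∈ integralClosure ℤ K := h.integral
    have hβ : β ∈ integralClosure ℤ K := h.symm.integral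
    let α₀ : integralClosure ℤ K := ⟨α, hα⟩
    let β₀ : integralClosure ℤ K := ⟨β, hβ⟩
    have : quinticElt α β = ((quinticElt α₀ β₀ : integralClosure ℤ K) : K) := by
      exact (map_quinticElt (integralClosure ℤ K).val.toRingHom α₀ β₀).symm
    rw [this]
    exact (quinticElt α₀ β₀).2
  adjoin_eq_top := by
    refine (Field.primitive_element_iff_algHom_eq_of_eval' ℚ ℂ
      (fun x => IsAlgClosed.splits _) _).mpr fun σ τ hστ => ?_
    by_contra hne
    have hinj := (Field.primitive_element_iff_algHom_eq_of_eval' ℚ ℂ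
      (fun x => IsAlgClosed.splits _) α).mp h.adjoin_eq_top
    have hmap (σ : K →ₐ[ℚ] ℂ) : σ β = σ α ^ 2 - r ∧ σ α = σ β ^ 2 - s ∧
        σ (quinticElt α β) = quinticElt (σ α) (σ β) := by
      refine ⟨by rw [h.right_eq]; simp, ?_, map_quinticElt σ.toRingHom α β⟩
      conv_lhs => rw [h.left_eq]
      simp
    refine quinticElt_ne (hmap σ).1 (hmap σ).2.1 (hmap τ).1 (hmap τ).2.1 (fun h0 => hne (hinj h0))
      (h.integral.map (σ.restrictScalars ℤ)) (h.integral.map (τ.restrictScalars ℤ)) ?_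
    rw [← (hmap σ).2.2, ← (hmap τ).2.2]
    exact hστ
  right_eq := by
    rw [quinticElt_relation h.right_eq h.left_eq]
    simp [quinticParam]
  left_eq := by
    rw [quinticElt_relation h.left_eq h.right_eq]
    simp [quinticParam]

end IsQuarticPair

/-- A zero of `quarticPoly r s` starts an infinite sequence of pairs. -/
theorem exists_injective_isQuarticPair {K : Type*} [Field K] [NumberField K] {r s : ℤ} {α β : K}
    (h : IsQuarticPair r s α β) (hrs : ¬ (r = 0 ∧ s = 0)) :
    ∃ (r s : ℕ → ℤ) (α β : ℕ → K), (∀ m, IsQuarticPair (r m) (s m) (α m) (β m)) ∧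
      Function.Injective fun m => (α m, β m) := by
  let P : ℕ → ℤ × ℤ := fun m => (fun p => (quinticParam p.1 p.2, quinticParam p.2 p.1))^[m] (r, s)
  let E : ℕ → K × K := fun m => (fun p => (quinticElt p.1 p.2, quinticElt p.2 p.1))^[m] (α, β)
  have hP (m : ℕ) : P (m + 1) = (quinticParam (P m).1 (P m).2, quinticParam (P m).2 (P m).1) :=
    Function.iterate_succ_apply' _ _ _
  have hE (m : ℕ) : E (m + 1) = (quinticElt (E m).1 (E m).2, quinticElt (E m).2 (E m).1) :=
    Function.iterate_succ_apply' _ _ _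
  have hpair (m : ℕ) : IsQuarticPair (P m).1 (P m).2 (E m).1 (E m).2 := by
    induction m with
    | zero => exact h
    | succ m ih => rw [hP, hE]; exact ih.quintic
  have hne (m : ℕ) : ¬ ((P m).1 = 0 ∧ (P m).2 = 0) ∧
      max |(P m).1| |(P m).2| < max |(P (m + 1)).1| |(P (m + 1)).2| := by
    induction m with
    | zero => exact ⟨hrs, hP 0 ▸ max_abs_lt_max_abs_quinticParam hrs⟩
    | succ m ih =>
      have h0 : ¬ ((P (m + 1)).1 = 0 ∧ (P (m + 1)).2 = 0) := by
        rintro ⟨h1, h2⟩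
        have := ih.2
        rw [h1, h2, abs_zero, max_self] at this
        exact absurd this (not_lt.mpr (le_max_of_le_left (abs_nonneg _)))
      exact ⟨h0, hP (m + 1) ▸ max_abs_lt_max_abs_quinticParam h0⟩
  refine ⟨fun m => (P m).1, fun m => (P m).2, fun m => (E m).1, fun m => (E m).2, hpair, ?_⟩
  intro m k hmk
  obtain ⟨h1, h2⟩ : (E m).1 = (E k).1 ∧ (E m).2 = (E k).2 := Prod.mk.inj hmk
  refine (strictMono_nat_of_lt_succ fun m => (hne m).2).injective ?_
  -- the pair determines its parameters
  have hr : (P m).1 = (P k).1 := by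
    have := (hpair m).right_eq.symm.trans (h2.trans (hpair k).right_eq)
    rw [h1] at this
    exact_mod_cast sub_right_injective this
  have hs : (P m).2 = (P k).2 := by
    have := (hpair m).left_eq.symm.trans (h1.trans (hpair k).left_eq)
    rw [h2] at this
    exact_mod_cast sub_right_injective this
  simp only [hr, hs]

/-! ### Galois group `S₄` and conjugates inside the field -/

/-- If the Galois group of `p` is the full symmetric group, a point stabilizer fixes no further
root: the field generated by one root contains no other root of `p`. -/
theorem eq_of_aeval_eq_zero_of_gal_equiv_perm {n : ℕ} (hn : 3 ≤ n) {p : ℚ[X]} (hp : Irreducible p)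
    (hdeg : p.natDegree = n) (hgal : Nonempty (p.Gal ≃* Equiv.Perm (Fin n)))
    {K : Type*} [Field K] [NumberField K] {θ θ' : K} (hθ : aeval θ p = 0) (hθ' : aeval θ' p = 0)
    (hK : IntermediateField.adjoin ℚ {θ} = ⊤) : θ' = θ := by
  classical
  -- the rational structure here is `DivisionRing.toRatAlgebra`, not that of the closure
  have : Normal ℚ (AlgebraicClosure ℚ) :=
    { toIsAlgebraic := by
        convert AlgebraicClosure.isAlgebraic ℚ
        exact Subsingleton.elim _ _
      splits' := fun _ => IsAlgClosed.splits _ }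
  have : Fact ((p.map (algebraMap ℚ (AlgebraicClosure ℚ))).Splits) := ⟨IsAlgClosed.splits _⟩
  let φ : K →ₐ[ℚ] (AlgebraicClosure ℚ) := IsAlgClosed.lift
  have hcard : Fintype.card (p.rootSet (AlgebraicClosure ℚ)) = n := by
    rw [card_rootSet_eq_natDegree hp.separable (IsAlgClosed.splits _), hdeg]
  have hroot {t : K} (ht : aeval t p = 0) : φ t ∈ p.rootSet (AlgebraicClosure ℚ) :=
    mem_rootSet.mpr ⟨hp.ne_zero, by rw [aeval_algHom_apply, ht, map_zero]⟩
  have hsurj : Function.Surjective (Gal.galActionHom p (AlgebraicClosure ℚ)) := by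
    refine ((Nat.bijective_iff_injective_and_card _).mpr
      ⟨Gal.galActionHom_injective p (AlgebraicClosure ℚ), ?_⟩).surjective
    obtain ⟨g⟩ := hgal
    rw [Nat.card_congr g.toEquiv, Nat.card_perm, Nat.card_perm, Nat.card_eq_fintype_card,
      Nat.card_eq_fintype_card, hcard, Fintype.card_fin]
  let x : p.rootSet (AlgebraicClosure ℚ) := ⟨φ θ, hroot hθ⟩
  let y : p.rootSet (AlgebraicClosure ℚ) := ⟨φ θ', hroot hθ'⟩
  by_contra hne
  have hxy : x ≠ y := fun h => hne (φ.injective (congrArg Subtype.val h).symm)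
  obtain ⟨z, hzx, hzy⟩ : ∃ z, z ≠ x ∧ z ≠ y := by
    obtain ⟨z, -, hz⟩ := Finset.exists_mem_notMem_of_card_lt_card
      (s := {x, y}) (t := Finset.univ) (Finset.card_le_two.trans_lt (by
        rw [Finset.card_univ, hcard]; omega))
    exact ⟨z, by simpa using hz⟩
  obtain ⟨σ, hσ⟩ := hsurj (Equiv.swap y z)
  obtain ⟨ψ, rfl⟩ := Gal.restrict_surjective p (AlgebraicClosure ℚ) σ
  have hψ (w : p.rootSet (AlgebraicClosure ℚ)) :
      ψ w = (Equiv.swap y z w : p.rootSet (AlgebraicClosure ℚ)) := by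
    rw [← hσ, Gal.galActionHom_restrict]
  have hx : ψ (φ θ) = φ θ := by
    have := hψ x
    rwa [Equiv.swap_apply_of_ne_of_ne hxy hzx.symm] at this
  have hcomp : (ψ : (AlgebraicClosure ℚ) →ₐ[ℚ] (AlgebraicClosure ℚ)).comp φ = φ :=
    (Field.primitive_element_iff_algHom_eq_of_eval' ℚ (AlgebraicClosure ℚ)
      (fun x => IsAlgClosed.splits _) θ).mp hK hx
  have hy := hψ y
  rw [Equiv.swap_apply_left] at hy
  exact hzy (Subtype.ext (hy.symm.trans (DFunLike.congr_fun hcomp θ')))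

namespace IsQuarticPair

variable {K : Type*} [Field K] [NumberField K] {r s : ℤ} {α β : K}

/-- `1, α, α ^ 2, α ^ 3` are linearly independent. -/
theorem coeff_eq_zero (h : IsQuarticPair r s α β) (hK : Module.finrank ℚ K = 4) {a b c d : ℤ}
    (h0 : (a : K) * α ^ 3 + b * α ^ 2 + c * α + d = 0) : a = 0 ∧ b = 0 ∧ c = 0 ∧ d = 0 := by
  have h1 : aeval α (C a * X ^ 3 + C b * X ^ 2 + C c * X + C d : ℤ[X]) = 0 := by
    simpa using h0
  have h2 := minpoly.isIntegrallyClosed_dvd h.integral h1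
  rw [h.minpoly_eq hK] at h2
  have h3 : (C a * X ^ 3 + C b * X ^ 2 + C c * X + C d : ℤ[X]) = 0 := by
    by_contra hne
    have h4 := natDegree_le_of_dvd h2 hne
    rw [natDegree_quarticPoly] at h4
    have h5 : (C a * X ^ 3 + C b * X ^ 2 + C c * X + C d : ℤ[X]).natDegree ≤ 3 :=
      natDegree_cubic_le
    omega
  have h4 := fun n => congrArg (fun q => coeff q n) h3
  have e0 := h4 0
  have e1 := h4 1
  have e2 := h4 2
  have e3 := h4 3
  simp only [coeff_add, coeff_C_mul, coeff_X_pow, coeff_X, coeff_C, coeff_zero] at e0 e1 e2 e3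
  norm_num at e0 e1 e2 e3
  exact ⟨e3, e2, e1, e0⟩

/-- If `K` has no nontrivial automorphism, `α` is the only zero of its minimal polynomial in `K`. -/
theorem eq_of_aeval_minpoly (h : IsQuarticPair r s α β)
    (hrigid : ∀ ρ : K →ₐ[ℚ] K, ρ = AlgHom.id ℚ K)
    {y : K} (hy : aeval y (minpoly ℤ α) = 0) : y = α := by
  have hint : IsIntegral ℚ α := h.integral.tower_top
  have hy' : aeval y (minpoly ℚ α) = 0 := by
    rw [minpoly.isIntegrallyClosed_eq_field_fractions' ℚ h.integral, aeval_map_algebraMap, hy]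
  let g : IntermediateField.adjoin ℚ {α} →ₐ[ℚ] K :=
    (IntermediateField.algHomAdjoinIntegralEquiv ℚ hint).symm
      ⟨y, mem_aroots.mpr ⟨minpoly.ne_zero hint, hy'⟩⟩
  have hg : g (IntermediateField.AdjoinSimple.gen ℚ α) = y :=
    IntermediateField.algHomAdjoinIntegralEquiv_symm_apply_gen ℚ hint _
  let ι : K ≃ₐ[ℚ] IntermediateField.adjoin ℚ {α} :=
    ((IntermediateField.equivOfEq h.adjoin_eq_top).trans IntermediateField.topEquiv).symm
  have hι : ι α = IntermediateField.AdjoinSimple.gen ℚ α := by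
    refine (AlgEquiv.symm_apply_eq _).mpr ?_
    rfl
  have := DFunLike.congr_fun (hrigid (g.comp (ι : K →ₐ[ℚ] _))) α
  rw [← hg, ← hι]
  exact this

/-- An equivalence would express `α` as a fractional linear function of `β = α ^ 2 - r`, which is
a nontrivial relation of degree at most `3` for `α`. -/
theorem not_gl2Equiv (h : IsQuarticPair r s α β) (hK : Module.finrank ℚ K = 4)
    (hrigid : ∀ ρ : K →ₐ[ℚ] K, ρ = AlgHom.id ℚ K) :
    ¬ GL2Equiv (minpoly ℤ α) (minpoly ℤ β) := by
  rintro ⟨n, hf, hg, γ, hγ⟩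
  have hγdet : γ.val 0 0 * γ.val 1 1 - γ.val 0 1 * γ.val 1 0 ≠ 0 := by
    rw [← Matrix.det_fin_two]
    exact ((Matrix.isUnit_iff_isUnit_det _).mp γ.isUnit).ne_zero
  set a := γ.val 0 0 with ha
  set b := γ.val 0 1 with hb
  set c := γ.val 1 0 with hc
  set d := γ.val 1 1 with hd
  have hv : (c * β + d : K) ≠ 0 := by
    intro h0
    obtain ⟨-, -, hc0, hd0⟩ := h.symm.coeff_eq_zero hK (a := 0) (b := 0) (c := c) (d := d)
      (by simpa using h0)
    simp [hc0, hd0] at hγdet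
  have hG : MvPolynomial.aeval ![β, 1] ((minpoly ℤ β).homogenize n) = 0 := by
    rw [aeval_homogenize_of_eq_one hg.le _ (by simp)]
    simp
  have hF : MvPolynomial.aeval ![a * β + b, c * β + d] ((minpoly ℤ α).homogenize n) = 0 := by
    have h1 : MvPolynomial.aeval ![β, 1] (linSubst γ.val ((minpoly ℤ α).homogenize n)) = 0 := by
      rcases hγ with hγ | hγ
      · rw [← hγ, hG]
      · rw [← neg_eq_iff_eq_neg.mpr hγ, map_neg, hG, neg_zero]
    rw [linSubst, ← AlgHom.comp_apply, MvPolynomial.comp_aeval] at h1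
    convert h1 using 2
    congr 1
    ext i
    fin_cases i <;> simp [ha, hb, hc, hd]
  have hroot : aeval ((a * β + b : K) / (c * β + d)) (minpoly ℤ α) = 0 := by
    have h1 := eval_homogenize (p := (minpoly ℤ α).map (algebraMap ℤ K)) (n := n)
      (natDegree_map_le.trans hf.le) ![a * β + b, c * β + d] (by simpa using hv)
    rw [homogenize_map, MvPolynomial.eval_map, ← MvPolynomial.aeval_def, hF] at h1
    have h2 := (mul_eq_zero.mp h1.symm).resolve_right (pow_ne_zero _ (by simpa using hv))
    rw [eval_map_algebraMap] at h2
    simpa using h2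
  have hα := h.eq_of_aeval_minpoly hrigid hroot
  rw [div_eq_iff hv] at hα
  obtain ⟨hc0, ha0, -, -⟩ := h.coeff_eq_zero hK (a := c) (b := -a) (c := d - c * r)
    (d := a * r - b) (by
      have h1 := h.right_eq
      push_cast
      linear_combination -hα + (a - α * c) * h1)
  rw [neg_eq_zero] at ha0
  simp [hc0, ha0] at hγdet

end IsQuarticPair

/-! ### Sequences of pairs -/

theorem finite_range_of_factors {ι X Y : Type*} {f : ι → X} {g : ι → Y}
    (hf : (Set.range f).Finite) (h : ∀ m k, f m = f k → g m = g k) : (Set.range g).Finite := by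
  rcases isEmpty_or_nonempty Y with _ | _
  · exact Set.toFinite _
  have hg : Function.FactorsThrough g f := fun m k hmk => h m k hmk
  refine (hf.image (Function.extend f g fun _ => Classical.arbitrary Y)).subset ?_
  rintro _ ⟨m, rfl⟩
  exact ⟨f m, ⟨m, rfl⟩, hg.extend_apply _ m⟩

theorem IsBEGSequence.exists_isQuarticPair {K : Type*} [Field K] [NumberField K] {α β : ℕ → K}
    (h : IsBEGSequence α β) :
    ∃ r s : ℕ → ℤ, ∀ m, IsQuarticPair (r m) (s m) (α m) (β m) := by
  choose r hr using h.exists_right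
  choose s hs using h.exists_left
  exact ⟨fun m => -r m, fun m => -s m, fun m => ⟨h.integral_left m, h.adjoin_left m,
    by rw [hr]; simp, by rw [Int.cast_neg, sub_neg_eq_add, ← hs]⟩⟩

theorem mainTheorem6 (r s : ℤ)
    (hirr : Irreducible ((quarticPoly r s).map (Int.castRingHom ℚ)))
    (hgal : Nonempty (((quarticPoly r s).map (Int.castRingHom ℚ)).Gal ≃* Equiv.Perm (Fin 4)))
    {K : Type*} [Field K] [NumberField K] (θ : K) (hθ : aeval θ (quarticPoly r s) = 0)
    (hK : IntermediateField.adjoin ℚ {θ} = ⊤) :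
    (∃ α β : ℕ → K, Function.Injective (fun m => (α m, β m)) ∧ IsBEGSequence α β) ∧
    ∀ α β : ℕ → K, IsBEGSequence α β →
      (Set.range fun m => Quotient.mk hermiteSetoid (minpoly ℤ (α m))).Infinite ∧
      ∀ m, HermiteEquiv (minpoly ℤ (α m)) (minpoly ℤ (β m)) ∧
        ¬ GL2Equiv (minpoly ℤ (α m)) (minpoly ℤ (β m)) := by
  have hroot {t : K} (ht : aeval t (quarticPoly r s) = 0) :
      aeval t ((quarticPoly r s).map (Int.castRingHom ℚ)) = 0 := by
    rw [← algebraMap_int_eq, aeval_map_algebraMap, ht]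
  have hdeg : ((quarticPoly r s).map (Int.castRingHom ℚ)).natDegree = 4 := by
    rw [(monic_quarticPoly r s).natDegree_map, natDegree_quarticPoly]
  have hfin : Module.finrank ℚ K = 4 := by
    rw [← (Field.primitive_element_iff_minpoly_natDegree_eq ℚ θ).mp hK, ← hdeg,
      minpoly.eq_of_irreducible_of_monic hirr (hroot hθ) ((monic_quarticPoly r s).map _)]
  have hrigid (ρ : K →ₐ[ℚ] K) : ρ = AlgHom.id ℚ K := by
    have h1 : ρ θ = θ := eq_of_aeval_eq_zero_of_gal_equiv_perm (by norm_num) hirr hdeg hgal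
      (hroot hθ) (by rw [aeval_algHom_apply, hroot hθ, map_zero]) hK
    refine AlgHom.ext_of_adjoin_eq_top (s := {θ}) ?_ ?_
    · rw [← IntermediateField.adjoin_simple_toSubalgebra_of_isAlgebraic
        (Algebra.IsAlgebraic.isAlgebraic θ), hK,
        IntermediateField.top_toSubalgebra]
    · rintro _ rfl
      exact h1
  refine ⟨?_, fun α β h => ?_⟩
  · have hpair : IsQuarticPair r s θ (θ ^ 2 - r) :=
      ⟨⟨quarticPoly r s, monic_quarticPoly r s, hθ⟩, hK, rfl, by
        simp [quarticPoly] at hθ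
        linear_combination -hθ⟩
    -- `quarticPoly 0 0` has the zero `0`
    have hrs : ¬ (r = 0 ∧ s = 0) := by
      rintro ⟨rfl, rfl⟩
      have := hpair.eq_of_aeval_minpoly hrigid (y := 0) (by
        rw [hpair.minpoly_eq hfin]; simp [quarticPoly])
      obtain ⟨-, -, h1, -⟩ := hpair.coeff_eq_zero hfin (a := 0) (b := 0) (c := 1) (d := 0)
        (by simp [← this])
      exact one_ne_zero h1
    obtain ⟨r', s', α, β, h, hinj⟩ := exists_injective_isQuarticPair hpair hrs
    refine ⟨α, β, hinj, fun m => (h m).integral, fun m => (h m).symm.integral,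
      fun m => (h m).adjoin_eq_top, fun m => (h m).symm.adjoin_eq_top,
      fun m => ⟨-r' m, by rw [(h m).right_eq]; push_cast; ring⟩,
      fun m => ⟨-s' m, by rw [Int.cast_neg, ← sub_eq_add_neg]; exact (h m).left_eq⟩, fun hO => ?_⟩
    -- an order determines the discriminant, so finitely many orders leave finitely many pairs
    refine Set.infinite_range_of_injective hinj
      (IsQuarticPair.finite_range_of_finite_range_quarticDisc h ?_)
    exact finite_range_of_factors hO fun m k hmk =>
      (h m).quarticDisc_eq_of_adjoin_eq (h k) hfin hmk
  · obtain ⟨r', s', hp⟩ := h.exists_isQuarticPair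
    refine ⟨fun hC => h.infinite_orders ?_, fun m => ⟨(hp m).hermiteEquiv hfin,
      (hp m).not_gl2Equiv hfin hrigid⟩⟩
    have hpairs := IsQuarticPair.finite_range_of_finite_range_quarticDisc hp
      (finite_range_of_factors hC fun m k hmk =>
        (hp m).quarticDisc_eq_of_hermiteEquiv (hp k) hfin (Quotient.exact hmk))
    refine finite_range_of_factors hpairs fun m k hmk => ?_
    rw [(Prod.mk.inj hmk).1]
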